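/- All graphs are finite and simple, $\lambda(G)$ denotes the spectral radius of $G$, that is, the maximum modulus of the eigenvalues of its adjacency matrix, and equality of graphs is understood up to isomorphism. For integers $m\ge 2$ and $q\ge 1$, let $T_{m,2}$ be the complete bipartite graph on $m$ vertices with partite sets of sizes $\lfloor m/2\rfloor$ and $\lceil m/2\rceil$, and let $T_{m,2}\circ K_q$ be the $(m+q-1)$-vertex graph obtained by identifying a vertex of the complete graph $K_q$ with a vertex of a partite set of size $\lfloor m/2\rfloor$ of $T_{m,2}$. Let $\mathcal G^*_{n,r}$ be the family of $n$-vertex graphs $G$ that are obtained from a bipartite graph $B$ by suspending graphs $G_1,\dots,G_s$ for some $s\in\mathbb N$, with $\sum_{i=1}^s|V(G_i)\setminus V(B)|=r-2$; that is, $G$ is the union of its subgraphs $B,G_1,\dots,G_s$, where $B$ is bipartite, each $G_i$ has exactly one vertex in common with $B$, and distinct $G_i,G_j$ have no common vertex outside $B$. Let $n,k,r$ be integers with $n\ge 100k$ and $3\le r\le 10k$. (1) We have $T_{n-r+2,2}\circ K_{r-1}\in\mathcal G^*_{n,r}$, and every $G\in\mathcal G^*_{n,r}$ satisfies $$\lambda(G)\le\lambda(T_{n-r+2,2}\circ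 K_{r-1}),$$ with equality if and only if $G=T_{n-r+2,2}\circ K_{r-1}$. (2) For every integer $s$ with $r<s\le 10k$, $$\lambda(T_{n-s+2,2}\circ K_{s-1})<\lambda(T_{n-r+2,2}\circ K_{r-1}).$$ -/

import Mathlib

open scoped ENNReal

namespace SpectralSuspension

open Classical in
/-- The spectral radius `λ(G)` of a finite graph: the maximum modulus of the eigenvalues of its
adjacency matrix. That matrix is real symmetric, so its eigenvalues are all real. -/
noncomputable def specRad {V : Type*} [Fintype V] (G : SimpleGraph V) : ℝ≥0∞ :=
  spectralRadius ℝ (G.adjMatrix ℝ)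

/-- The graph obtained from the disjoint union of `G` and `H` by identifying the vertex `u` of `G`
with the vertex `v` of `H`; the identified vertex is `Sum.inl u`. -/
def identify {V W : Type*} (G : SimpleGraph V) (u : V) (H : SimpleGraph W) (v : W) :
    SimpleGraph (V ⊕ {w : W // w ≠ v}) where
  Adj
    | .inl x, .inl y => G.Adj x y
    | .inl x, .inr w => x = u ∧ H.Adj v w
    | .inr w, .inl x => x = u ∧ H.Adj v w
    | .inr w, .inr z => H.Adj w z
  symm := ⟨by
    rintro (x | w) (y | z) h
    · exact G.adj_symm h
    · exact h
    · exact h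
    · exact H.adj_symm h⟩
  loopless := ⟨by
    rintro (x | w) h
    · exact G.loopless.irrefl x h
    · exact H.loopless.irrefl _ h⟩

/-- The graph `T_{m,2} ∘ K_q`: a vertex of the complete graph `K_q` is identified with a vertex of
the smaller partite set of the bipartite Turán graph `T_{m,2}`. In `SimpleGraph.turanGraph m 2` the
partite sets are the even and the odd elements of `{0, …, m - 1}`, of sizes `⌈m/2⌉` and `⌊m/2⌋`;
so the vertex `1` lies in the one of size `⌊m/2⌋`. -/
def turanCircClique (m q : ℕ) (hm : 2 ≤ m) (hq : 1 ≤ q) :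
    SimpleGraph (Fin m ⊕ {w : Fin q // w ≠ ⟨0, hq⟩}) :=
  identify (SimpleGraph.turanGraph m 2) ⟨1, hm⟩ (⊤ : SimpleGraph (Fin q)) ⟨0, hq⟩

/-- `G` is an `n`-vertex graph obtained from a bipartite graph `B` by suspending graphs
`H 0, …, H (s - 1)`, with exactly `r - 2` vertices outside `B`. Each `H i` meets `B` in exactly one
vertex, different `H i` have no common vertex outside `B`, and `G` is the union of `B` and the
`H i`. -/
def IsBipartiteSuspension {V : Type*} [Fintype V] (n r : ℕ) (G : SimpleGraph V) : Prop :=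
  Fintype.card V = n ∧
  ∃ (B : G.Subgraph) (s : ℕ) (H : Fin s → G.Subgraph),
    B.coe.IsBipartite ∧
    (∀ i, ∃ v, (H i).verts ∩ B.verts = {v}) ∧
    (∀ i j, i ≠ j → (H i).verts ∩ (H j).verts ⊆ B.verts) ∧
    B ⊔ (⨆ i, H i) = ⊤ ∧
    (∑ i, ((H i).verts \ B.verts).ncard) + 2 = r

end SpectralSuspension

/-! Every member of the family lies in a model graph: a complete bipartite core, each core vertex
`v` carrying a clique with `x_v` further vertices. Eliminating the clique at `v` from the eigenvalue
equation for `t` multiplies the Perron entry at `v` by `1 + gain t x_v`. With colour classes of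
sizes `a ≤ b`, and `f₁`, `f₂` the sums of the gains over them, the equation becomes `(a + f₁) * (b +
f₂) = t ^ 2`. If the product is only at most `t ^ 2`, the same vector is a positive supersolution
and still gives `λ ≤ t` (`specRad_le_of_le_suspModel`).

Fix `t` as the spectral radius of the extremal graph, and let `p = r - 2`. The gain is
superadditive, even with an extra product term (`gain_add_le`), and `gain t p < 1`. So the product
is largest when one clique takes all `p` vertices, sits in the smaller class and the core is
balanced (`prod_le_of_le`); its value is then `t ^ 2`.

In the equality case connectivity of the model forces `G` to be the whole model
(`eq_suspModel_of_specRad_eq`), and equality in the numerical bound forces the extremal shape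
(`eq_of_prod_eq`), up to exchanging classes of equal size.

For (2), the same supersolution at the `t` of `r` is used for `s`: a smaller core loses more in the
product than a gain below `1 / 2` can restore. -/

namespace SpectralSuspension

/-! ### Spectral radius, supersolutions and their equality case -/

section Spectral

open Classical Finset

variable {V : Type*} [Fintype V]

/-- The action of the adjacency matrix of `G` on a vector. -/
noncomputable def adjSum (G : SimpleGraph V) (x : V → ℝ) (v : V) : ℝ :=
  ∑ w, if G.Adj v w then x w else 0

lemma adjMatrix_mulVec_eq_adjSum (G : SimpleGraph V) (x : V → ℝ) :
    (G.adjMatrix ℝ).mulVec x = adjSum G x := by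
  ext v
  simp [adjSum, Matrix.mulVec, dotProduct, SimpleGraph.adjMatrix_apply]

lemma mem_spectrum_adjMatrix_iff (G : SimpleGraph V) (t : ℝ) :
    t ∈ spectrum ℝ (G.adjMatrix ℝ) ↔ ∃ x : V → ℝ, x ≠ 0 ∧ ∀ v, adjSum G x v = t * x v := by
  rw [← Matrix.spectrum_toLin', ← Module.End.hasEigenvalue_iff_mem_spectrum]
  constructor
  · intro h
    obtain ⟨x, hx⟩ := h.exists_hasEigenvector
    refine ⟨x, hx.2, fun v => ?_⟩
    have := hx.apply_eq_smul
    rw [Matrix.toLin'_apply, adjMatrix_mulVec_eq_adjSum] at this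
    simpa using congrFun this v
  · rintro ⟨x, hx, h⟩
    refine Module.End.hasEigenvalue_of_hasEigenvector (x := x) ⟨?_, hx⟩
    rw [Module.End.mem_eigenspace_iff, Matrix.toLin'_apply, adjMatrix_mulVec_eq_adjSum]
    ext v
    simpa using h v

lemma sum_mul_adjSum_comm (G : SimpleGraph V) (x y : V → ℝ) :
    ∑ v, y v * adjSum G x v = ∑ v, x v * adjSum G y v := by
  simp only [adjSum, mul_sum]
  rw [sum_comm]
  refine sum_congr rfl fun v _ => sum_congr rfl fun w _ => ?_
  simp only [G.adj_comm w v]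
  split_ifs <;> ring

lemma adjSum_mono {G G' : SimpleGraph V} (h : G ≤ G') {x : V → ℝ} (hx : ∀ v, 0 ≤ x v) (v : V) :
    adjSum G x v ≤ adjSum G' x v := by
  refine sum_le_sum fun w _ => ?_
  by_cases hG : G.Adj v w
  · simp [hG, h hG]
  · simp only [hG, if_false]
    split_ifs
    · exact hx w
    · exact le_rfl

lemma le_adjSum (G : SimpleGraph V) {x : V → ℝ} (hx : ∀ v, 0 ≤ x v) {v w : V} (h : G.Adj v w) :
    x w ≤ adjSum G x v := by
  have := single_le_sum (f := fun w => if G.Adj v w then x w else 0)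
    (fun i _ => by split_ifs <;> simp [hx]) (mem_univ w)
  simpa [adjSum, h] using this

lemma abs_mul_abs_le_adjSum_abs (G : SimpleGraph V) {x : V → ℝ} {t : ℝ}
    (h : ∀ v, adjSum G x v = t * x v) (v : V) : |t| * |x v| ≤ adjSum G (fun w => |x w|) v := by
  rw [← abs_mul, ← h v]
  refine (abs_sum_le_sum_abs _ _).trans (sum_le_sum fun w _ => ?_)
  split_ifs <;> simp

lemma ofReal_le_specRad (G : SimpleGraph V) {x : V → ℝ} (hx : x ≠ 0) {t : ℝ}
    (h : ∀ v, adjSum G x v = t * x v) : ENNReal.ofReal t ≤ specRad G := by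
  have hmem := (mem_spectrum_adjMatrix_iff G t).2 ⟨x, hx, h⟩
  refine le_trans ?_ (le_iSup₂ (f := fun (k : ℝ) (_ : k ∈ spectrum ℝ (G.adjMatrix ℝ)) =>
    (‖k‖₊ : ℝ≥0∞)) t hmem)
  rw [← enorm_eq_nnnorm, Real.enorm_eq_ofReal_abs]
  exact ENNReal.ofReal_le_ofReal (le_abs_self t)

/-- Pair `y` with `|x|` for an eigenvector `x`: symmetry moves the adjacency matrix from `|x|` to
`y`, and the pairing is positive, so it cancels. -/
lemma specRad_le_of_adjSum_le (G : SimpleGraph V) {y : V → ℝ} (hy : ∀ v, 0 < y v) {t : ℝ}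
    (h : ∀ v, adjSum G y v ≤ t * y v) : specRad G ≤ ENNReal.ofReal t := by
  refine iSup₂_le fun s hs => ?_
  obtain ⟨x, hx, hxs⟩ := (mem_spectrum_adjMatrix_iff G s).1 hs
  rw [← enorm_eq_nnnorm, Real.enorm_eq_ofReal_abs]
  refine ENNReal.ofReal_le_ofReal ?_
  have h1 : |s| * ∑ v, y v * |x v| ≤ t * ∑ v, y v * |x v| := by
    calc |s| * ∑ v, y v * |x v| = ∑ v, y v * (|s| * |x v|) := by
          rw [mul_sum]; exact sum_congr rfl fun v _ => by ring
      _ ≤ ∑ v, y v * adjSum G (fun w => |x w|) v :=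
          sum_le_sum fun v _ => mul_le_mul_of_nonneg_left
            (abs_mul_abs_le_adjSum_abs G hxs v) (hy v).le
      _ = ∑ v, |x v| * adjSum G y v := sum_mul_adjSum_comm G _ _
      _ ≤ ∑ v, |x v| * (t * y v) :=
          sum_le_sum fun v _ => mul_le_mul_of_nonneg_left (h v) (abs_nonneg _)
      _ = t * ∑ v, y v * |x v| := by
          rw [mul_sum]; exact sum_congr rfl fun v _ => by ring
  refine le_of_mul_le_mul_right h1 ?_
  obtain ⟨v, hv⟩ := Function.ne_iff.1 hx
  exact sum_pos' (fun v _ => mul_nonneg (hy v).le (abs_nonneg _))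
    ⟨v, mem_univ v, mul_pos (hy v) (abs_pos.2 hv)⟩

/-- The spectral radius is attained, and the modulus of an eigenvector is a subsolution. -/
lemma exists_nonneg_subsolution (G : SimpleGraph V) {t : ℝ} (ht : 0 < t)
    (h : specRad G = ENNReal.ofReal t) :
    ∃ z : V → ℝ, z ≠ 0 ∧ (∀ v, 0 ≤ z v) ∧ ∀ v, t * z v ≤ adjSum G z v := by
  have hfin : (spectrum ℝ (G.adjMatrix ℝ)).Finite := Matrix.finite_spectrum _
  have hne : (spectrum ℝ (G.adjMatrix ℝ)).Nonempty := by
    -- The supremum over an empty spectrum is `0`, which `0 < t` excludes.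
    by_contra hcon
    rw [Set.not_nonempty_iff_eq_empty] at hcon
    have : specRad G = 0 := by simp [specRad, spectralRadius, hcon]
    rw [h, ENNReal.ofReal_eq_zero] at this
    linarith
  obtain ⟨s, hs, hmax⟩ := hfin.exists_maximalFor (fun k : ℝ => (‖k‖₊ : ℝ≥0∞)) _ hne
  have hsr : specRad G = ENNReal.ofReal |s| := by
    rw [← Real.enorm_eq_ofReal_abs, enorm_eq_nnnorm]
    refine le_antisymm (iSup₂_le fun k hk => ?_) (le_iSup₂ (f := fun (k : ℝ)
      (_ : k ∈ spectrum ℝ (G.adjMatrix ℝ)) => (‖k‖₊ : ℝ≥0∞)) s hs)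
    rcases le_total (‖k‖₊ : ℝ≥0∞) ‖s‖₊ with h' | h'
    · exact h'
    · exact hmax hk h'
  rw [h, ENNReal.ofReal_eq_ofReal_iff ht.le (abs_nonneg s)] at hsr
  obtain ⟨x, hx, hxs⟩ := (mem_spectrum_adjMatrix_iff G s).1 hs
  refine ⟨fun v => |x v|, ?_, fun v => abs_nonneg _, fun v => ?_⟩
  · obtain ⟨v, hv⟩ := Function.ne_iff.1 hx
    exact Function.ne_iff.2 ⟨v, abs_ne_zero.2 hv⟩
  · rw [hsr]
    exact abs_mul_abs_le_adjSum_abs G hxs v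

/-- Equality in `specRad_le_of_adjSum_le`, for a subgraph of the graph with the test vector. -/
lemma exists_eigenvector_of_specRad_eq {G G' : SimpleGraph V} (hG : G ≤ G') {y : V → ℝ}
    (hy : ∀ v, 0 < y v) {t : ℝ} (ht : 0 < t) (h : ∀ v, adjSum G' y v ≤ t * y v)
    (hs : specRad G = ENNReal.ofReal t) :
    ∃ z : V → ℝ, z ≠ 0 ∧ (∀ v, 0 ≤ z v) ∧ (∀ v, adjSum G z v = t * z v) ∧
      (∀ v, adjSum G' z v = t * z v) ∧ ∀ v, 0 < z v → adjSum G' y v = t * y v := by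
  obtain ⟨z, hz0, hz, hzt⟩ := exists_nonneg_subsolution G ht hs
  have hmono := adjSum_mono hG hz
  -- By symmetry the slack of the subsolution `z` and that of the supersolution `y`, each weighted
  -- by the other vector, cancel; both are nonnegative, so every term vanishes.
  have e1 : ∑ v, y v * (adjSum G' z v - t * z v) + ∑ v, z v * (t * y v - adjSum G' y v) = 0 := by
    have := sum_mul_adjSum_comm G' z y
    simp only [mul_sub, sum_sub_distrib]
    rw [this]
    have : ∑ v, y v * (t * z v) = ∑ v, z v * (t * y v) := sum_congr rfl fun v _ => by ring
    rw [this]; ring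
  have p1 : ∀ v ∈ univ, 0 ≤ y v * (adjSum G' z v - t * z v) := fun v _ =>
    mul_nonneg (hy v).le (by linarith [hzt v, hmono v])
  have p2 : ∀ v ∈ univ, 0 ≤ z v * (t * y v - adjSum G' y v) := fun v _ =>
    mul_nonneg (hz v) (by linarith [h v])
  have q1 := (sum_eq_zero_iff_of_nonneg p1).1 (by linarith [sum_nonneg p1, sum_nonneg p2])
  have q2 := (sum_eq_zero_iff_of_nonneg p2).1 (by linarith [sum_nonneg p1, sum_nonneg p2])
  have q1' : ∀ v, adjSum G' z v = t * z v := fun v => by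
    have := (mul_eq_zero.1 (q1 v (mem_univ v))).resolve_left (hy v).ne'
    linarith
  refine ⟨z, hz0, hz, fun v => le_antisymm ?_ (hzt v), q1', fun v hv => ?_⟩
  · exact (hmono v).trans (q1' v).le
  · have := (mul_eq_zero.1 (q2 v (mem_univ v))).resolve_left hv.ne'
    linarith

lemma eq_of_adjSum_eq {G G' : SimpleGraph V} (hG : G ≤ G') {z : V → ℝ} (hz : ∀ v, 0 < z v)
    (h : ∀ v, adjSum G z v = adjSum G' z v) : G = G' := by
  refine le_antisymm hG fun v w hvw => ?_
  by_contra hcon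
  refine (h v).not_lt (sum_lt_sum (fun u _ => ?_) ⟨w, mem_univ w, ?_⟩)
  · by_cases h1 : G.Adj v u
    · simp [h1, hG h1]
    · simp only [h1, if_false]
      split_ifs
      · exact (hz u).le
      · exact le_rfl
  · simp [hvw, hcon, hz w]

lemma specRad_congr {W : Type*} [Fintype W] {G : SimpleGraph V} {H : SimpleGraph W}
    (e : G ≃g H) : specRad G = specRad H := by
  have key : spectrum ℝ (G.adjMatrix ℝ) = spectrum ℝ (H.adjMatrix ℝ) := by
    ext t
    rw [mem_spectrum_adjMatrix_iff, mem_spectrum_adjMatrix_iff]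
    constructor
    · rintro ⟨x, hx, h⟩
      refine ⟨x ∘ e.symm, ?_, fun w => ?_⟩
      · obtain ⟨v, hv⟩ := Function.ne_iff.1 hx
        exact Function.ne_iff.2 ⟨e v, by simpa using hv⟩
      · have := h (e.symm w)
        rw [Function.comp_apply, ← this]
        refine (Fintype.sum_equiv e.toEquiv _ _ fun v => ?_).symm
        have : G.Adj (e.symm w) v ↔ H.Adj w (e v) := by
          rw [← e.map_adj_iff]; simp
        simp [this]
    · rintro ⟨x, hx, h⟩
      refine ⟨x ∘ e, ?_, fun w => ?_⟩
      · obtain ⟨v, hv⟩ := Function.ne_iff.1 hx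
        exact Function.ne_iff.2 ⟨e.symm v, by simpa using hv⟩
      · have := h (e w)
        rw [Function.comp_apply, ← this]
        refine Fintype.sum_equiv e.toEquiv _ _ fun v => ?_
        simp [e.map_adj_iff]
  unfold specRad spectralRadius
  rw [key]

end Spectral

/-! ### Complete bipartite cores with suspended cliques -/

section Model

open Classical Finset

variable {V : Type*} [Fintype V]

/-- For a retraction `π` of `V` onto a core and a colouring `col`, the graph whose edges join
different vertices of the same fibre of `π`, and core vertices of different colours. -/
def suspModel (π : V → V) (col : V → Bool) : SimpleGraph V where
  Adj u w := u ≠ w ∧ (π u = π w ∨ (π u = u ∧ π w = w ∧ col u ≠ col w))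
  symm := ⟨fun _ _ h => ⟨h.1.symm, h.2.imp Eq.symm fun h' => ⟨h'.2.1, h'.1, h'.2.2.symm⟩⟩⟩
  loopless := ⟨fun _ h => h.1 rfl⟩

/-- The core vertices of a given colour. -/
noncomputable def colorClass (π : V → V) (col : V → Bool) (c : Bool) : Finset V :=
  univ.filter fun v => π v = v ∧ col v = c

/-- The number of vertices in the fibre of `π` over `v`, other than `v` itself. -/
noncomputable def excess (π : V → V) (v : V) : ℕ :=
  #{w | π w = v ∧ w ≠ v}

/-- The relative increase of the entry of a Perron vector at a vertex at which a clique with `x`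
further vertices is suspended. -/
noncomputable def gain (t x : ℝ) : ℝ := x / ((t + 1) * (t - x))

/-- The weight of a colour class. -/
noncomputable def sideWeight (π : V → V) (col : V → Bool) (t : ℝ) (c : Bool) : ℝ :=
  ∑ v ∈ colorClass π col c, (1 + gain t (excess π v))

/-- The test vector, with scale `α c` on the part belonging to the core vertices of colour `c`. -/
noncomputable def testVec (π : V → V) (col : V → Bool) (t : ℝ) (α : Bool → ℝ) (w : V) : ℝ :=
  α (col (π w)) / (t + 1) * ((if π w = w then 1 else 0) + 1 / (t - excess π (π w)))

variable {π : V → V} {col : V → Bool}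

lemma mem_colorClass {c : Bool} {v : V} : v ∈ colorClass π col c ↔ π v = v ∧ col v = c := by
  simp [colorClass]

/-- Adding `x u` completes the neighbours in the fibre to the whole fibre, so only core vertices
have a further contribution. -/
lemma adjSum_suspModel_add (π : V → V) (col : V → Bool) (x : V → ℝ) (u : V) :
    adjSum (suspModel π col) x u + x u = ∑ w ∈ univ.filter (fun w => π w = π u), x w +
      if π u = u then ∑ w ∈ colorClass π col (!col u), x w else 0 := by
  have h2 : (if π u = u then ∑ w ∈ colorClass π col (!col u), x w else 0) =
      ∑ w, if π u = u ∧ π w = w ∧ col w = !col u then x w else 0 := by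
    split_ifs with h
    · simp [colorClass, sum_filter, h]
    · simp [h]
  have h1 : x u = ∑ w, if w = u then x w else 0 := by simp
  rw [h2, adjSum]
  rw [h1]
  rw [sum_filter, ← sum_add_distrib, ← sum_add_distrib]
  refine sum_congr rfl fun w _ => ?_
  by_cases hwu : w = u
  · subst hwu; simp [suspModel]
  · by_cases hf : π w = π u
    · have : ¬ (π u = u ∧ π w = w ∧ col w = !col u) := by
        rintro ⟨h, h', -⟩; exact hwu (by rw [← h', hf, h])
      rw [if_neg this]
      simp [suspModel, hwu, hf, Ne.symm hwu]
    · have : col u ≠ col w ↔ col w = !col u := by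
        cases col u <;> cases col w <;> simp
      simp [suspModel, hwu, hf, Ne.symm hwu, Ne.symm hf, this]

lemma card_fiber (hπ : ∀ v, π (π v) = π v) (u : V) :
    (#{w | π w = π u} : ℝ) = excess π (π u) + 1 := by
  have : univ.filter (fun w => π w = π u) =
      insert (π u) (univ.filter fun w => π w = π u ∧ w ≠ π u) := by
    ext w
    by_cases h : w = π u
    · simp [h, hπ]
    · simp [h]
  rw [this, card_insert_of_notMem (by simp)]
  simp [excess]

/-- Here `α c` stands for the intended sum over the class opposite to `c`. Writing `e` for the
excess, the fibre sum `F` must solve `(t + 1) * F = α + (e + 1) * F`, whence `F = α / (t - e)`. -/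
lemma sum_fiber_testVec (hπ : ∀ v, π (π v) = π v) {t : ℝ} (ht : 0 < t) (α : Bool → ℝ) (u : V)
    (hu : (excess π (π u) : ℝ) < t) :
    ∑ w ∈ univ.filter (fun w => π w = π u), testVec π col t α w =
      α (col (π u)) / (t - excess π (π u)) := by
  have h1 : ∑ w ∈ univ.filter (fun w => π w = π u), testVec π col t α w =
      ∑ w ∈ univ.filter (fun w => π w = π u), α (col (π u)) / (t + 1) *
        ((if w = π u then 1 else 0) + 1 / (t - excess π (π u))) := by
    refine sum_congr rfl fun w hw => ?_
    rw [mem_filter] at hw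
    rw [testVec, hw.2]
    simp only [eq_comm]
  rw [h1, ← mul_sum, sum_add_distrib, sum_const, nsmul_eq_mul, card_fiber hπ u]
  have : ∑ w ∈ univ.filter (fun w => π w = π u), (if w = π u then (1 : ℝ) else 0) = 1 := by
    rw [sum_ite_eq']; simp [hπ]
  rw [this]
  have h3 : t - excess π (π u) ≠ 0 := by linarith
  have h4 : t + 1 ≠ 0 := by linarith
  field_simp
  ring

lemma testVec_core {t : ℝ} (ht : 0 < t) (α : Bool → ℝ) {v : V} (hv : π v = v)
    (hx : (excess π v : ℝ) < t) :
    testVec π col t α v = α (col v) / t * (1 + gain t (excess π v)) := by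
  rw [testVec, hv, gain]
  simp only [if_true]
  have h3 : t - excess π v ≠ 0 := by linarith
  have h4 : t + 1 ≠ 0 := by linarith
  field_simp
  ring

lemma sum_colorClass_testVec {t : ℝ} (ht : 0 < t) (hx : ∀ v, (excess π v : ℝ) < t)
    (α : Bool → ℝ) (c : Bool) :
    ∑ w ∈ colorClass π col c, testVec π col t α w = α c / t * sideWeight π col t c := by
  rw [sideWeight, mul_sum]
  refine sum_congr rfl fun v hv => ?_
  rw [mem_colorClass] at hv
  rw [testVec_core ht α hv.1 (hx v), hv.2]

/-- The error term is the actual sum over the opposite class minus the intended one; vertices off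
the core never see it. -/
lemma adjSum_testVec (hπ : ∀ v, π (π v) = π v) {t : ℝ} (ht : 0 < t)
    (hx : ∀ v, (excess π v : ℝ) < t) (α : Bool → ℝ) (u : V) :
    adjSum (suspModel π col) (testVec π col t α) u = t * testVec π col t α u +
      if π u = u then α (!col u) / t * sideWeight π col t (!col u) - α (col u) else 0 := by
  have h1 := adjSum_suspModel_add π col (testVec π col t α) u
  rw [sum_fiber_testVec hπ ht α u (hx _), sum_colorClass_testVec ht hx] at h1
  have h2 : (t + 1) * testVec π col t α u =
      α (col (π u)) * (if π u = u then 1 else 0) + α (col (π u)) / (t - excess π (π u)) := by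
    rw [testVec]
    have h4 : t + 1 ≠ 0 := by linarith
    field_simp
  by_cases h : π u = u
  · rw [if_pos h] at h1 h2 ⊢
    simp only [h] at h1 h2
    linarith
  · rw [if_neg h] at h1 h2 ⊢
    linarith

lemma gain_nonneg {t x : ℝ} (hx : 0 ≤ x) (hxt : x < t) : 0 ≤ gain t x :=
  div_nonneg hx (mul_nonneg (by linarith) (by linarith))

lemma sideWeight_pos {t : ℝ} (hx : ∀ v, (excess π v : ℝ) < t) {c : Bool}
    (hc : (colorClass π col c).Nonempty) : 0 < sideWeight π col t c :=
  sum_pos (fun v _ => by linarith [gain_nonneg (Nat.cast_nonneg _) (hx v)]) hc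

lemma testVec_pos {t : ℝ} (ht : 0 < t) (hx : ∀ v, (excess π v : ℝ) < t) {α : Bool → ℝ}
    (hα : ∀ c, 0 < α c) (v : V) : 0 < testVec π col t α v := by
  have := hx (π v)
  refine mul_pos (div_pos (hα _) (by linarith)) (add_pos_of_nonneg_of_pos ?_ ?_)
  · split_ifs <;> simp
  · exact one_div_pos.2 (by linarith)

/-- The scales for which the test vector satisfies the eigenvalue equation everywhere except
possibly at the core vertices of colour `false`. -/
noncomputable def scale (π : V → V) (col : V → Bool) (t : ℝ) : Bool → ℝ
  | true => sideWeight π col t false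
  | false => t

lemma scale_pos {t : ℝ} (ht : 0 < t) (hx : ∀ v, (excess π v : ℝ) < t)
    (hc : ∀ c, (colorClass π col c).Nonempty) (c : Bool) : 0 < scale π col t c := by
  cases c
  · exact ht
  · exact sideWeight_pos hx (hc false)

lemma adjSum_testVec_scale (hπ : ∀ v, π (π v) = π v) {t : ℝ} (ht : 0 < t)
    (hx : ∀ v, (excess π v : ℝ) < t) (u : V) :
    adjSum (suspModel π col) (testVec π col t (scale π col t)) u =
      t * testVec π col t (scale π col t) u +
      if π u = u ∧ col u = false then
        (sideWeight π col t true * sideWeight π col t false - t ^ 2) / t else 0 := by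
  rw [adjSum_testVec hπ ht hx]
  congr 1
  by_cases h : π u = u
  · cases hc : col u
    · simp only [h, scale]
      simp
      field_simp
    · simp only [h, scale]
      simp
      field_simp
      simp
  · simp [h]

lemma adjSum_testVec_scale_le (hπ : ∀ v, π (π v) = π v) {t : ℝ} (ht : 0 < t)
    (hx : ∀ v, (excess π v : ℝ) < t)
    (hp : sideWeight π col t true * sideWeight π col t false ≤ t ^ 2) (u : V) :
    adjSum (suspModel π col) (testVec π col t (scale π col t)) u ≤
      t * testVec π col t (scale π col t) u := by
  rw [adjSum_testVec_scale hπ ht hx]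
  split_ifs
  · have := div_nonpos_of_nonpos_of_nonneg (sub_nonpos.2 hp) ht.le
    linarith
  · simp

lemma specRad_le_of_le_suspModel (hπ : ∀ v, π (π v) = π v) {t : ℝ} (ht : 0 < t)
    (hx : ∀ v, (excess π v : ℝ) < t) (hc : ∀ c, (colorClass π col c).Nonempty)
    (hp : sideWeight π col t true * sideWeight π col t false ≤ t ^ 2)
    {G : SimpleGraph V} (hG : G ≤ suspModel π col) : specRad G ≤ ENNReal.ofReal t := by
  have hy := testVec_pos (π := π) (col := col) ht hx (scale_pos ht hx hc)
  refine specRad_le_of_adjSum_le G hy fun v => ?_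
  exact (adjSum_mono hG (fun v => (hy v).le) v).trans (adjSum_testVec_scale_le hπ ht hx hp v)

lemma specRad_suspModel_eq (hπ : ∀ v, π (π v) = π v) {t : ℝ} (ht : 0 < t)
    (hx : ∀ v, (excess π v : ℝ) < t) (hc : ∀ c, (colorClass π col c).Nonempty)
    (hp : sideWeight π col t true * sideWeight π col t false = t ^ 2) :
    specRad (suspModel π col) = ENNReal.ofReal t := by
  refine le_antisymm (specRad_le_of_le_suspModel hπ ht hx hc hp.le le_rfl) ?_
  refine ofReal_le_specRad _ (x := testVec π col t (scale π col t)) ?_ fun v => ?_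
  · obtain ⟨v, -⟩ := hc true
    exact Function.ne_iff.2 ⟨v, (testVec_pos ht hx (scale_pos ht hx hc) v).ne'⟩
  · rw [adjSum_testVec_scale hπ ht hx, hp]
    simp

/-- Positivity spreads along edges, and the model is connected: fibres are cliques, and nonempty
classes are completely joined. A core vertex of the same colour is reached in two steps. -/
lemma pos_of_adjSum_eq (hπ : ∀ v, π (π v) = π v) (hc : ∀ c, (colorClass π col c).Nonempty)
    {t : ℝ} (ht : 0 < t) {z : V → ℝ} (hz0 : z ≠ 0) (hz : ∀ v, 0 ≤ z v)
    (h : ∀ v, adjSum (suspModel π col) z v = t * z v) (v : V) : 0 < z v := by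
  have step : ∀ u w, (suspModel π col).Adj u w → 0 < z w → 0 < z u := fun u w huw hw => by
    have := le_adjSum (suspModel π col) hz huw
    rw [h u] at this
    exact pos_of_mul_pos_right (hw.trans_le this) ht.le
  have fib : ∀ u w, π u = π w → 0 < z w → 0 < z u := fun u w huw hw => by
    by_cases e : u = w
    · rwa [e]
    · exact step u w ⟨e, Or.inl huw⟩ hw
  have opp : ∀ c, ∀ w ∈ colorClass π col c, 0 < z w → ∀ u ∈ colorClass π col (!c), 0 < z u := by
    intro c w hw hzw u hu
    rw [mem_colorClass] at hw hu
    have hne : col u ≠ col w := by rw [hu.2, hw.2]; cases c <;> simp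
    exact step u w ⟨fun e => hne (by rw [e]), Or.inr ⟨hu.1, hw.1, hne⟩⟩ hzw
  obtain ⟨w, hw⟩ := Function.ne_iff.1 hz0
  have hw' : 0 < z (π w) := fib _ w (hπ w) (lt_of_le_of_ne (hz w) (Ne.symm hw))
  have h1 := opp (col (π w)) (π w) (mem_colorClass.2 ⟨hπ w, rfl⟩) hw'
  obtain ⟨b, hb⟩ := hc (!col (π w))
  have h2 := opp _ b hb (h1 b hb)
  refine fib v (π v) (hπ v).symm ?_
  by_cases e : col (π v) = col (π w)
  · exact h2 _ (mem_colorClass.2 ⟨hπ v, by simp [e]⟩)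
  · refine h1 _ (mem_colorClass.2 ⟨hπ v, ?_⟩)
    revert e
    cases col (π v) <;> cases col (π w) <;> simp

/-- Equality gives a common eigenvector of `G` and the model, positive by connectivity, so no edge
is missing. Then the test vector is exact at every vertex; at a core vertex of colour `false` this
reads as equality in `hp`. -/
lemma eq_suspModel_of_specRad_eq (hπ : ∀ v, π (π v) = π v) {t : ℝ} (ht : 0 < t)
    (hx : ∀ v, (excess π v : ℝ) < t) (hc : ∀ c, (colorClass π col c).Nonempty)
    (hp : sideWeight π col t true * sideWeight π col t false ≤ t ^ 2)
    {G : SimpleGraph V} (hG : G ≤ suspModel π col) (hs : specRad G = ENNReal.ofReal t) :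
    G = suspModel π col ∧ sideWeight π col t true * sideWeight π col t false = t ^ 2 := by
  have hy := testVec_pos (π := π) (col := col) ht hx (scale_pos ht hx hc)
  obtain ⟨z, hz0, hz, hzG, hzM, hyM⟩ := exists_eigenvector_of_specRad_eq hG hy ht
    (adjSum_testVec_scale_le hπ ht hx hp) hs
  have hzpos := pos_of_adjSum_eq hπ hc ht hz0 hz hzM
  refine ⟨eq_of_adjSum_eq hG hzpos fun v => by rw [hzG, hzM], ?_⟩
  obtain ⟨v, hv⟩ := hc false
  have h1 := hyM v (hzpos v)
  rw [adjSum_testVec_scale hπ ht hx, if_pos (mem_colorClass.1 hv)] at h1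
  have h2 : (sideWeight π col t true * sideWeight π col t false - t ^ 2) / t = 0 := by linarith
  rcases div_eq_zero_iff.1 h2 with h3 | h3
  · linarith
  · exact absurd h3 ht.ne'

end Model

/-! ### Superadditivity of the gain and the optimal product -/

section Numeric

open Classical Finset

/-- The difference is an explicit fraction, nonnegative because `2 * t - x - y ≥ t - (x + y)` and `t
+ 1 ≥ 1`. The product term covers cliques on opposite sides. -/
lemma gain_add_le {t x y : ℝ} (hx : 0 ≤ x) (hy : 0 ≤ y) (h : x + y < t) :
    gain t x + gain t y + gain t x * gain t y ≤ gain t (x + y) := by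
  unfold gain
  have h1 : 0 < t - (x + y) := by linarith
  have h2 : 0 < t - x := by linarith
  have h3 : 0 < t - y := by linarith
  have h4 : 0 < t + 1 := by linarith
  rw [← sub_nonneg]
  have : (x + y) / ((t + 1) * (t - (x + y))) - (x / ((t + 1) * (t - x)) + y / ((t + 1) * (t - y)) +
      x / ((t + 1) * (t - x)) * (y / ((t + 1) * (t - y)))) =
      x * y * ((t + 1) * (2 * t - x - y) - (t - (x + y))) /
        ((t + 1) ^ 2 * (t - x) * (t - y) * (t - (x + y))) := by
    field_simp
    ring
  rw [this]
  refine div_nonneg (mul_nonneg (mul_nonneg hx hy) ?_) (by positivity)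
  nlinarith

lemma gain_lt_one {t x : ℝ} (hx : 0 ≤ x) (h : 2 * x < t) : gain t x < 1 := by
  unfold gain
  rw [div_lt_one (mul_pos (by linarith) (by linarith))]
  nlinarith

lemma gain_pos {t x : ℝ} (hx : 0 < x) (hxt : x < t) : 0 < gain t x :=
  div_pos hx (mul_pos (by linarith) (by linarith))

lemma gain_zero (t : ℝ) : gain t 0 = 0 := by simp [gain]

lemma gain_eq_mul (t x : ℝ) : gain t x = x * (1 / ((t + 1) * (t - x))) := by
  rw [gain, mul_one_div]

variable {ι : Type*}

/-- The ratio of `gain t x` to `x` increases with `x`, so every term is bounded using the ratio at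
`P`. -/
lemma sum_gain_le {t P : ℝ} (s : Finset ι) (p : ι → ℝ) (hp : ∀ i ∈ s, 0 ≤ p i)
    (hs : ∑ i ∈ s, p i = P) (hP : P < t) : ∑ i ∈ s, gain t (p i) ≤ gain t P := by
  rw [gain_eq_mul t P, ← hs, sum_mul, hs]
  refine sum_le_sum fun i hi => ?_
  have h0 : p i ≤ P := hs ▸ single_le_sum hp hi
  have := hp i hi
  rw [gain_eq_mul]
  have : 0 < t - P := by linarith
  have : 0 < t + 1 := by linarith
  gcongr

/-- Equality in `sum_gain_le` forces the whole sum to be concentrated in one term. -/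
lemma exists_eq_of_sum_gain_eq {t P : ℝ} (s : Finset ι) (p : ι → ℝ) (hp : ∀ i ∈ s, 0 ≤ p i)
    (hs : ∑ i ∈ s, p i ≤ P) (hP : P < t) (hP0 : 0 < P)
    (h : ∑ i ∈ s, gain t (p i) = gain t P) : ∃ i ∈ s, p i = P := by
  by_contra! hcon
  have h0 : ∀ i ∈ s, p i < P := fun i hi =>
    lt_of_le_of_ne ((single_le_sum hp hi).trans hs) (hcon i hi)
  have hpos : ∃ i ∈ s, 0 < p i := by
    by_contra! hz
    have : ∑ i ∈ s, gain t (p i) = 0 := sum_eq_zero fun i hi => by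
      rw [le_antisymm (hz i hi) (hp i hi), gain_zero]
    linarith [gain_pos hP0 hP]
  obtain ⟨j, hj, hj0⟩ := hpos
  have hA : 0 < t - P := by linarith
  have hB : 0 < t + 1 := by linarith
  have h1 : ∑ i ∈ s, gain t (p i) < ∑ i ∈ s, p i * (1 / ((t + 1) * (t - P))) := by
    refine sum_lt_sum (fun i hi => ?_) ⟨j, hj, ?_⟩
    · have := h0 i hi
      have := hp i hi
      rw [gain_eq_mul]
      gcongr
    · have := h0 j hj
      rw [gain_eq_mul]
      gcongr
  rw [← sum_mul, h, gain_eq_mul t P] at h1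
  have : (∑ i ∈ s, p i) * (1 / ((t + 1) * (t - P))) ≤ P * (1 / ((t + 1) * (t - P))) := by gcongr
  linarith

/-- Shifting `d` vertices away from balance costs at least `d ^ 2 ≥ d`. -/
lemma mul_le_half_mul_half {a b m : ℕ} (hab : a ≤ b) (hm : a + b = m) :
    (a : ℝ) * b + ((b : ℝ) - ((m + 1) / 2 : ℕ)) ≤ ((m / 2 : ℕ) : ℝ) * ((m + 1) / 2 : ℕ) := by
  obtain ⟨d, hd⟩ : ∃ d, b = (m + 1) / 2 + d := Nat.exists_eq_add_of_le (by omega)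
  have ha : a + d = m / 2 := by omega
  have h2 : (m / 2 : ℕ) ≤ (m + 1) / 2 := by omega
  rw [← ha] at h2 ⊢
  rw [hd]
  generalize (m + 1) / 2 = e at *
  have hdd : (d : ℝ) ≤ d * d := by exact_mod_cast Nat.le_mul_self d
  have : ((a + d : ℕ) : ℝ) ≤ e := by exact_mod_cast h2
  push_cast at *
  have : (0 : ℝ) ≤ d := Nat.cast_nonneg d
  nlinarith

/-- Since `a ≤ b` and `1 ≤ b`, the left side is at most `a * b + b * f`. An excess of `b` over the
balanced size adds that excess times `f`, less than what imbalance costs. -/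
lemma prod_le_of_le {a b m : ℕ} (hab : a ≤ b) (hm : a + b = m) (hb : 1 ≤ b) {f f₁ f₂ : ℝ}
    (h₁ : 0 ≤ f₁) (h₂ : 0 ≤ f₂) (hf : f₁ + f₂ + f₁ * f₂ ≤ f) (hf1 : f < 1) :
    (a + f₁) * (b + f₂) ≤ ((m / 2 : ℕ) : ℝ) * ((m + 1) / 2 : ℕ) + ((m + 1) / 2 : ℕ) * f := by
  have h := mul_le_half_mul_half hab hm
  have hb' : (1 : ℝ) ≤ b := by exact_mod_cast hb
  have hab' : (a : ℝ) ≤ b := by exact_mod_cast hab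
  have hbe : (((m + 1) / 2 : ℕ) : ℝ) ≤ b := by exact_mod_cast (by omega : (m + 1) / 2 ≤ b)
  generalize (((m + 1) / 2 : ℕ) : ℝ) = e at *
  have h12 : 0 ≤ f₁ * f₂ := mul_nonneg h₁ h₂
  nlinarith [mul_le_mul_of_nonneg_left hf (by linarith : (0 : ℝ) ≤ b),
    mul_nonneg (sub_nonneg.2 hbe) (sub_nonneg.2 hf1.le), mul_nonneg (sub_nonneg.2 hab') h₂,
    mul_nonneg (sub_nonneg.2 hb') h12]

lemma eq_of_prod_eq {a b m : ℕ} (hab : a ≤ b) (hm : a + b = m) (hb : 2 ≤ b) {f f₁ f₂ : ℝ}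
    (h₁ : 0 ≤ f₁) (h₂ : 0 ≤ f₂) (hf : f₁ + f₂ + f₁ * f₂ ≤ f) (hf1 : f < 1)
    (heq : (a + f₁) * (b + f₂) =
      ((m / 2 : ℕ) : ℝ) * ((m + 1) / 2 : ℕ) + ((m + 1) / 2 : ℕ) * f) :
    a = m / 2 ∧ b = (m + 1) / 2 ∧ ((f₁ = f ∧ f₂ = 0) ∨ (a = b ∧ f₁ = 0 ∧ f₂ = f)) := by
  have h := mul_le_half_mul_half hab hm
  have hb' : (2 : ℝ) ≤ b := by exact_mod_cast hb
  have hab' : (a : ℝ) ≤ b := by exact_mod_cast hab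
  have hbe : (((m + 1) / 2 : ℕ) : ℝ) ≤ b := by exact_mod_cast (by omega : (m + 1) / 2 ≤ b)
  have h12 : 0 ≤ f₁ * f₂ := mul_nonneg h₁ h₂
  have i1 := mul_le_mul_of_nonneg_left hf (by linarith : (0 : ℝ) ≤ b)
  have i2 := mul_nonneg (sub_nonneg.2 hbe) (sub_nonneg.2 hf1.le)
  have i3 := mul_nonneg (sub_nonneg.2 hab') h₂
  have i4 := mul_nonneg (sub_nonneg.2 hb') h12
  -- The three nonnegative slacks `i2`, `i3`, `i4` add up to at most the gap between the two sides,
  -- which is zero. Since `2 ≤ b`, the last one kills `f₁ * f₂`.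
  have k1 : ((b : ℝ) - ((m + 1) / 2 : ℕ)) * (1 - f) = 0 := by
    refine le_antisymm ?_ i2
    nlinarith
  have k2 : ((b : ℝ) - a) * f₂ = 0 := by
    refine le_antisymm ?_ i3
    nlinarith
  have k3 : f₁ * f₂ = 0 := by
    refine le_antisymm ?_ h12
    nlinarith
  have hbe' : b = (m + 1) / 2 := by
    have := (mul_eq_zero.1 k1).resolve_right (by linarith)
    have : (b : ℝ) = ((m + 1) / 2 : ℕ) := by linarith
    exact_mod_cast this
  have ha' : a = m / 2 := by omega
  have k4 : f₁ + f₂ = f := by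
    rw [← ha', ← hbe'] at heq
    have : (b : ℝ) * (f₁ + f₂ - f) = 0 := by nlinarith
    have := (mul_eq_zero.1 this).resolve_left (by linarith)
    linarith
  refine ⟨ha', hbe', ?_⟩
  rcases mul_eq_zero.1 k2 with hd | hd
  · have hab2 : a = b := by
      have : (a : ℝ) = b := by linarith
      exact_mod_cast this
    rcases mul_eq_zero.1 k3 with hz | hz
    · exact Or.inr ⟨hab2, hz, by linarith⟩
    · exact Or.inl ⟨by linarith, hz⟩
  · exact Or.inl ⟨by linarith, hd⟩

/-- The root which is the spectral radius of the extremal graph. -/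
lemma exists_extremal_root {m p : ℕ} (hp : 2 * p + 1 ≤ m / 2) :
    ∃ t : ℝ, ((m / 2 : ℕ) : ℝ) ≤ t ∧
      t ^ 2 = ((m / 2 : ℕ) : ℝ) * ((m + 1) / 2 : ℕ) + ((m + 1) / 2 : ℕ) * gain t p := by
  have h2 : (m / 2 : ℕ) ≤ (m + 1) / 2 := by omega
  have hm : m / 2 + (m + 1) / 2 = m := by omega
  generalize m / 2 = a at *
  generalize (m + 1) / 2 = b at *
  have hp' : 2 * (p : ℝ) + 1 ≤ a := by exact_mod_cast hp
  have h2' : (a : ℝ) ≤ b := by exact_mod_cast h2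
  have hp0 : (0 : ℝ) ≤ p := Nat.cast_nonneg p
  have hcont : ContinuousOn (fun t : ℝ => t ^ 2 - (a * b + b * gain t p))
      (Set.Icc (a : ℝ) (a + b)) := by
    unfold gain
    refine ContinuousOn.sub (by fun_prop) (ContinuousOn.add (by fun_prop)
      (ContinuousOn.mul (by fun_prop) (ContinuousOn.div (by fun_prop) (by fun_prop) ?_)))
    intro t ht
    have := ht.1
    exact (mul_pos (by linarith) (by linarith)).ne'
  -- At `t = a` the square is at most `a * b`; at `t = a + b` it exceeds `a * b + b`, while the gain
  -- is below `1`.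
  have hivt := intermediate_value_Icc (by linarith : (a : ℝ) ≤ a + b) hcont
  have g1 := gain_nonneg hp0 (by linarith : (p : ℝ) < a)
  have g2 := gain_lt_one hp0 (by linarith : 2 * (p : ℝ) < a + b)
  obtain ⟨t, ht, h0⟩ := hivt (show (0 : ℝ) ∈ Set.Icc _ _ from ⟨by nlinarith, by nlinarith⟩)
  exact ⟨t, ht.1, by dsimp only at h0; linarith⟩

end Numeric

/-! ### The extremal graph as a model -/

section Turan

open Classical Finset

variable {m q : ℕ}

/-- The retraction of the vertices of `turanCircClique` onto those of the Turán graph. -/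
def turanRetract (hm : 2 ≤ m) (hq : 1 ≤ q) :
    Fin m ⊕ {w : Fin q // w ≠ ⟨0, hq⟩} → Fin m ⊕ {w : Fin q // w ≠ ⟨0, hq⟩}
  | .inl x => .inl x
  | .inr _ => .inl ⟨1, hm⟩

/-- The colouring of the vertices of the Turán graph in `turanCircClique`. -/
def turanColor (m : ℕ) (hq : 1 ≤ q) : Fin m ⊕ {w : Fin q // w ≠ ⟨0, hq⟩} → Bool
  | .inl x => decide ((x : ℕ) % 2 = 1)
  -- An arbitrary value: colours matter only at fixed points of the retraction.
  | .inr _ => false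

lemma turanRetract_idem (hm : 2 ≤ m) (hq : 1 ≤ q) (v) :
    turanRetract hm hq (turanRetract hm hq v) = turanRetract hm hq v := by
  rcases v with x | w <;> rfl

lemma turanCircClique_eq (hm : 2 ≤ m) (hq : 1 ≤ q) :
    turanCircClique m q hm hq = suspModel (turanRetract hm hq) (turanColor m hq) := by
  ext v w
  rcases v with x | v <;> rcases w with y | w
  · simp only [turanCircClique, identify, suspModel, turanRetract, turanColor,
      SimpleGraph.turanGraph_adj]
    have : decide ((x : ℕ) % 2 = 1) ≠ decide ((y : ℕ) % 2 = 1) ↔ (x : ℕ) % 2 ≠ y % 2 := by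
      rw [Ne, decide_eq_decide]; omega
    rw [this]
    by_cases h : x = y
    · simp [h]
    · simp [h]
  · have : (⟨0, hq⟩ : Fin q) ≠ w := w.2.symm
    simp [turanCircClique, identify, suspModel, turanRetract, this]
  · simp only [turanCircClique, identify, suspModel, turanRetract]
    simp [v.2.symm, eq_comm (a := y)]
  · simp [turanCircClique, identify, suspModel, turanRetract, Subtype.ext_iff]

lemma card_filter_mod_two (m : ℕ) :
    #{x : Fin m | (x : ℕ) % 2 = 1} = m / 2 ∧ #{x : Fin m | ¬ (x : ℕ) % 2 = 1} = (m + 1) / 2 := by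
  have h1 : #{x : Fin m | (x : ℕ) % 2 = 1} = m / 2 := by
    rw [card_filter, Fin.sum_univ_eq_sum_range (fun i => if i % 2 = 1 then 1 else 0)]
    induction m with
    | zero => simp
    | succ k ih => rw [sum_range_succ, ih]; split_ifs <;> omega
  have h2 := card_filter_add_card_filter_not (s := (univ : Finset (Fin m)))
    (fun x => (x : ℕ) % 2 = 1)
  rw [card_univ, Fintype.card_fin] at h2
  exact ⟨h1, by omega⟩

lemma colorClass_turan (hm : 2 ≤ m) (hq : 1 ≤ q) (c : Bool) :
    colorClass (turanRetract hm hq) (turanColor m hq) c =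
      (univ.filter fun x : Fin m => decide ((x : ℕ) % 2 = 1) = c).map Function.Embedding.inl := by
  ext v
  rw [mem_colorClass]
  rcases v with x | w <;> simp [turanRetract, turanColor]

lemma card_colorClass_turan (hm : 2 ≤ m) (hq : 1 ≤ q) :
    #(colorClass (turanRetract hm hq) (turanColor m hq) true) = m / 2 ∧
      #(colorClass (turanRetract hm hq) (turanColor m hq) false) = (m + 1) / 2 := by
  rw [colorClass_turan, colorClass_turan, card_map, card_map]
  simpa using card_filter_mod_two m

lemma card_ne_zero_fin (hq : 1 ≤ q) : Fintype.card {w : Fin q // w ≠ ⟨0, hq⟩} = q - 1 := by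
  rw [Fintype.card_subtype_compl, Fintype.card_fin, Fintype.card_subtype_eq]

lemma excess_turan (hm : 2 ≤ m) (hq : 1 ≤ q) (v) :
    excess (turanRetract hm hq) v = if v = .inl ⟨1, hm⟩ then q - 1 else 0 := by
  unfold excess
  split_ifs with h
  · subst h
    have hcard : #((univ : Finset {w : Fin q // w ≠ ⟨0, hq⟩}).map
        (Function.Embedding.inr (α := Fin m))) = q - 1 := by
      rw [card_map, card_univ, card_ne_zero_fin hq]
    rw [← hcard]
    refine congrArg card ?_
    ext v
    simp only [mem_filter_univ]
    rcases v with x | w <;> simp [turanRetract]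
  · rw [card_eq_zero, eq_empty_iff_forall_notMem]
    intro v hv
    simp only [mem_filter_univ] at hv
    obtain ⟨h1, h2⟩ := hv
    rcases v with x | w
    · exact h2 h1
    · exact h h1.symm

lemma sideWeight_turan_true (hm : 2 ≤ m) (hq : 1 ≤ q) (t : ℝ) :
    sideWeight (turanRetract hm hq) (turanColor m hq) t true =
      (m / 2 : ℕ) + gain t (q - 1 : ℕ) := by
  rw [sideWeight, sum_add_distrib, sum_const, (card_colorClass_turan hm hq).1, nsmul_one]
  congr 1
  rw [sum_eq_single (.inl ⟨1, hm⟩)]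
  · rw [excess_turan, if_pos rfl]
  · intro v _ hv
    rw [excess_turan, if_neg hv, Nat.cast_zero, gain_zero]
  · intro h
    exact absurd (mem_colorClass.2 ⟨by rfl, by rfl⟩) h

lemma sideWeight_turan_false (hm : 2 ≤ m) (hq : 1 ≤ q) (t : ℝ) :
    sideWeight (turanRetract hm hq) (turanColor m hq) t false = ((m + 1) / 2 : ℕ) := by
  rw [sideWeight, sum_add_distrib, sum_const, (card_colorClass_turan hm hq).2, nsmul_one,
    sum_eq_zero, add_zero]
  intro v hv
  rw [excess_turan, if_neg, Nat.cast_zero, gain_zero]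
  rintro rfl
  simp [mem_colorClass, turanColor] at hv

lemma colorClass_turan_nonempty (hm : 2 ≤ m) (hq : 1 ≤ q) (c : Bool) :
    (colorClass (turanRetract hm hq) (turanColor m hq) c).Nonempty := by
  rw [← card_pos]
  cases c
  · rw [(card_colorClass_turan hm hq).2]; omega
  · rw [(card_colorClass_turan hm hq).1]; omega

lemma excess_turan_lt (hm : 2 ≤ m) (hq : 1 ≤ q) {t : ℝ} (ht : ((q - 1 : ℕ) : ℝ) < t) (v) :
    (excess (turanRetract hm hq) v : ℝ) < t := by
  rw [excess_turan]
  split_ifs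
  · exact ht
  · have : (0 : ℝ) ≤ (q - 1 : ℕ) := Nat.cast_nonneg _
    simpa using this.trans_lt ht

lemma specRad_turanCircClique (hm : 2 ≤ m) (hq : 1 ≤ q) {t : ℝ} (ht : ((q - 1 : ℕ) : ℝ) < t)
    (h : t ^ 2 = ((m / 2 : ℕ) : ℝ) * ((m + 1) / 2 : ℕ) + ((m + 1) / 2 : ℕ) * gain t (q - 1 : ℕ)) :
    specRad (turanCircClique m q hm hq) = ENNReal.ofReal t := by
  rw [turanCircClique_eq]
  have ht0 : 0 < t := (Nat.cast_nonneg _).trans_lt ht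
  refine specRad_suspModel_eq (turanRetract_idem hm hq) ht0 (excess_turan_lt hm hq ht)
    (colorClass_turan_nonempty hm hq) ?_
  rw [sideWeight_turan_true, sideWeight_turan_false, h]
  ring

/-- The supersolution gives `≤`; equality would force the product of the side weights to be `t ^ 2`.
-/
lemma specRad_turanCircClique_lt (hm : 2 ≤ m) (hq : 1 ≤ q) {t : ℝ} (ht : ((q - 1 : ℕ) : ℝ) < t)
    (h : ((m / 2 : ℕ) : ℝ) * ((m + 1) / 2 : ℕ) + ((m + 1) / 2 : ℕ) * gain t (q - 1 : ℕ) < t ^ 2) :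
    specRad (turanCircClique m q hm hq) < ENNReal.ofReal t := by
  rw [turanCircClique_eq]
  have ht0 : 0 < t := (Nat.cast_nonneg _).trans_lt ht
  have hp : sideWeight (turanRetract hm hq) (turanColor m hq) t true *
      sideWeight (turanRetract hm hq) (turanColor m hq) t false < t ^ 2 := by
    rw [sideWeight_turan_true, sideWeight_turan_false]
    linarith
  refine lt_of_le_of_ne (specRad_le_of_le_suspModel (turanRetract_idem hm hq) ht0
    (excess_turan_lt hm hq ht) (colorClass_turan_nonempty hm hq) hp.le le_rfl) fun hs => ?_
  exact hp.ne (eq_suspModel_of_specRad_eq (turanRetract_idem hm hq) ht0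
    (excess_turan_lt hm hq ht) (colorClass_turan_nonempty hm hq) hp.le le_rfl hs).2

lemma turanCircClique_isBipartiteSuspension (hm : 2 ≤ m) (hq : 1 ≤ q) :
    IsBipartiteSuspension (m + q - 1) (q + 1) (turanCircClique m q hm hq) := by
  refine ⟨?_, ?_⟩
  · rw [Fintype.card_sum, Fintype.card_fin, card_ne_zero_fin hq]; omega
  set G := turanCircClique m q hm hq with hG
  let B : G.Subgraph := (⊤ : G.Subgraph).induce (Set.range Sum.inl)
  let H : G.Subgraph := (⊤ : G.Subgraph).induce (insert (.inl ⟨1, hm⟩) (Set.range Sum.inr))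
  refine ⟨B, 1, fun _ => H, ?_, ?_, ?_, ?_, ?_⟩
  · refine ⟨SimpleGraph.Coloring.mk
      (fun v => if turanColor m hq v.1 = true then (0 : Fin 2) else 1) ?_⟩
    rintro ⟨v, x, rfl⟩ ⟨w, y, rfl⟩ h
    have h' : G.Adj (.inl x) (.inl y) := B.coe_adj_sub _ _ h
    have h'' : (x : ℕ) % 2 ≠ y % 2 := h'
    simp only [turanColor, decide_eq_true_eq]
    split_ifs <;> omega
  · intro i
    refine ⟨.inl ⟨1, hm⟩, ?_⟩
    ext v
    rcases v with x | w <;> simp [B, H]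
  · intro i j hij
    exact absurd (Subsingleton.elim i j) hij
  · have hv : (B ⊔ ⨆ _ : Fin 1, H) = B ⊔ H := by rw [ciSup_const]
    rw [hv]
    refine SimpleGraph.Subgraph.ext ?_ ?_
    · ext v
      rcases v with x | w <;> simp [B, H]
    · ext v w
      rcases v with x | v <;> rcases w with y | w
      · simp only [B, H, SimpleGraph.Subgraph.sup_adj, SimpleGraph.Subgraph.induce_adj]
        simp
      all_goals
        simp only [B, H, SimpleGraph.Subgraph.sup_adj, SimpleGraph.Subgraph.induce_adj]
        simp [hG, turanCircClique, identify]
        try tauto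
  · have : H.verts \ B.verts = Set.range Sum.inr := by
      ext v
      rcases v with x | w <;> simp [B, H]
    simp only [this, univ_unique, sum_const, card_singleton, one_smul]
    rw [← Set.image_univ, Set.ncard_image_of_injective _ Sum.inr_injective, Set.ncard_univ,
      Nat.card_eq_fintype_card, card_ne_zero_fin hq]
    omega

end Turan

/-! ### Embedding the family in models and identifying the extremal graph -/

section Extremal

open Classical Finset

lemma suspModel_not {V : Type*} (π : V → V) (col : V → Bool) :
    suspModel π (fun v => !col v) = suspModel π col := by
  ext v w
  simp [suspModel]

variable {V : Type*} [Fintype V] {π : V → V} {col : V → Bool}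

lemma colorClass_not (π : V → V) (col : V → Bool) (c : Bool) :
    colorClass π (fun v => !col v) c = colorClass π col (!c) := by
  ext v
  simp only [mem_colorClass]
  cases col v <;> cases c <;> simp

lemma card_colorClass_add (π : V → V) (col : V → Bool) :
    #(colorClass π col true) + #(colorClass π col false) + #{v | π v ≠ v} = Fintype.card V := by
  have h1 : #{v | π v = v} + #{v | π v ≠ v} = Fintype.card V := by
    rw [← card_univ]
    exact card_filter_add_card_filter_not _
  have h2 := card_filter_add_card_filter_not (s := univ.filter fun v => π v = v)
    (fun v => col v = true)
  rw [filter_filter, filter_filter] at h2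
  simp only [Bool.not_eq_true] at h2
  unfold colorClass
  omega

lemma sum_excess (hπ : ∀ v, π (π v) = π v) :
    ∑ v ∈ colorClass π col true, excess π v + ∑ v ∈ colorClass π col false, excess π v =
      #{v | π v ≠ v} := by
  have hd : Disjoint (colorClass π col true) (colorClass π col false) := by
    rw [disjoint_left]
    intro v h1 h2
    rw [mem_colorClass] at h1 h2
    simp [h1.2] at h2
  rw [← sum_union hd, card_eq_sum_card_fiberwise (f := π)
    (t := colorClass π col true ∪ colorClass π col false)]
  · refine sum_congr rfl fun v hv => ?_
    unfold excess
    rw [filter_filter]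
    refine congrArg card (filter_congr fun w _ => ?_)
    constructor
    · rintro ⟨h, h'⟩
      exact ⟨fun e => h' (by rw [← e, h]), h⟩
    · rintro ⟨h, h'⟩
      exact ⟨h', fun e => h (by rw [h', e])⟩
  · intro v _
    simp only [coe_union, Set.mem_union, mem_coe, mem_colorClass, hπ, true_and]
    cases col (π v) <;> simp

/-- The role of a vertex in a model in which all fibres except that of `u` are trivial. -/
noncomputable def vertexRole (π : V → V) (col : V → Bool) (u v : V) : Fin 4 :=
  if π v ≠ v then 3 else if v = u then 0 else if col v = true then 1 else 2

/-- Adjacency between different vertices in terms of their roles. -/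
def roleRel (i j : Fin 4) : Prop :=
  (i = 3 ∧ j = 3) ∨ (i = 3 ∧ j = 0) ∨ (i = 0 ∧ j = 3) ∨ ((i = 0 ∨ i = 1) ∧ j = 2) ∨
    (i = 2 ∧ (j = 0 ∨ j = 1))

lemma suspModel_adj_iff_roleRel {u : V} (hu : u ∈ colorClass π col true)
    (hπu : ∀ v, π v ≠ v → π v = u) (v w : V) :
    (suspModel π col).Adj v w ↔
      v ≠ w ∧ roleRel (vertexRole π col u v) (vertexRole π col u w) := by
  rw [mem_colorClass] at hu
  obtain ⟨hu1, hu2⟩ := hu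
  refine and_congr_right fun hvw => ?_
  by_cases hv : π v = v <;> by_cases hw : π w = w
  · by_cases hvu : v = u <;> by_cases hwu : w = u <;> cases hcv : col v <;> cases hcw : col w <;>
      simp_all [vertexRole, roleRel]
  · have := hπu w hw
    by_cases hvu : v = u <;> cases hcv : col v <;> simp_all [vertexRole, roleRel]
  · have := hπu v hv
    rcases eq_or_ne w u with rfl | hwu
    · simp [vertexRole, roleRel, hw, this, hvw.symm]
    · have h' : π v ≠ w := by rw [this]; exact hwu.symm
      cases hcw : col w <;> simp [vertexRole, roleRel, hv, hw, hwu, hcw, h']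
  · have h1 := hπu v hv
    have h2 := hπu w hw
    simp [vertexRole, roleRel, hv, hw]
    rw [h1, h2]

lemma card_vertexRole {u : V} (hu : u ∈ colorClass π col true) :
    #{v | vertexRole π col u v = 0} = 1 ∧
    #{v | vertexRole π col u v = 1} = #(colorClass π col true) - 1 ∧
    #{v | vertexRole π col u v = 2} = #(colorClass π col false) ∧
    #{v | vertexRole π col u v = 3} = #{v | π v ≠ v} := by
  have hu' := mem_colorClass.1 hu
  refine ⟨?_, ?_, ?_, ?_⟩
  · rw [card_eq_one]
    refine ⟨u, ?_⟩
    ext v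
    simp only [mem_filter_univ, mem_singleton]
    unfold vertexRole
    by_cases h : v = u
    · simp [h, hu'.1]
    · simp only [h, if_false, iff_false]
      split_ifs <;> decide
  · rw [← card_erase_of_mem hu]
    refine congrArg card ?_
    ext v
    simp only [mem_filter_univ, mem_erase, mem_colorClass]
    unfold vertexRole
    by_cases h1 : π v = v <;> by_cases h : v = u <;> cases hc : col v <;> simp_all
  · refine congrArg card ?_
    ext v
    simp only [mem_filter_univ, mem_colorClass]
    unfold vertexRole
    by_cases h1 : π v = v <;> by_cases h : v = u <;> cases hc : col v <;> simp_all
  · refine congrArg card ?_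
    ext v
    simp only [mem_filter_univ]
    unfold vertexRole
    by_cases h1 : π v = v <;> by_cases h : v = u <;> cases hc : col v <;> simp_all

/-- Adjacency depends only on roles, so any bijection preserving roles is an isomorphism; one exists
because each role occurs equally often in both graphs. -/
lemma nonempty_iso_of_concentrated {W : Type*} [Fintype W] {π' : W → W} {col' : W → Bool}
    {u : V} {u' : W} (hu : u ∈ colorClass π col true) (hu' : u' ∈ colorClass π' col' true)
    (hπu : ∀ v, π v ≠ v → π v = u) (hπu' : ∀ v, π' v ≠ v → π' v = u')
    (h1 : #(colorClass π col true) = #(colorClass π' col' true))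
    (h2 : #(colorClass π col false) = #(colorClass π' col' false))
    (hcard : Fintype.card V = Fintype.card W) :
    Nonempty (suspModel π col ≃g suspModel π' col') := by
  have key : ∀ i, Nonempty
      ({v // vertexRole π col u v = i} ≃ {v // vertexRole π' col' u' v = i}) := by
    intro i
    rw [← Fintype.card_eq, Fintype.card_subtype, Fintype.card_subtype]
    obtain ⟨a0, a1, a2, a3⟩ := card_vertexRole hu
    obtain ⟨b0, b1, b2, b3⟩ := card_vertexRole hu'
    have c1 := card_colorClass_add π col
    have c2 := card_colorClass_add π' col'
    fin_cases i
    · exact a0.trans b0.symm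
    · exact a1.trans (by rw [h1]; exact b1.symm)
    · exact a2.trans (by rw [h2]; exact b2.symm)
    · exact a3.trans (Eq.trans (by omega) b3.symm)
  let e : V ≃ W := Equiv.ofFiberEquiv fun i => (key i).some
  have he : ∀ v, vertexRole π' col' u' (e v) = vertexRole π col u v := fun v =>
    Equiv.ofFiberEquiv_map _ v
  refine ⟨⟨e, fun {v w} => ?_⟩⟩
  rw [suspModel_adj_iff_roleRel hu hπu, suspModel_adj_iff_roleRel hu' hπu', he, he]
  simp

lemma apply_eq_of_excess_eq {u : V} (hP : excess π u = #{v | π v ≠ v}) :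
    ∀ v, π v ≠ v → π v = u := by
  have hsub : univ.filter (fun w => π w = u ∧ w ≠ u) ⊆ univ.filter fun v => π v ≠ v := by
    intro w hw
    rw [mem_filter_univ] at hw ⊢
    exact fun e => hw.2 (by rw [← e, hw.1])
  have heq := eq_of_subset_of_card_le hsub hP.ge
  intro v hv
  have : v ∈ univ.filter (fun w => π w = u ∧ w ≠ u) := by
    rw [heq, mem_filter_univ]; exact hv
  exact ((mem_filter_univ _).1 this).1

lemma sideWeight_eq (π : V → V) (col : V → Bool) (t : ℝ) (c : Bool) :
    sideWeight π col t c =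
      #(colorClass π col c) + ∑ v ∈ colorClass π col c, gain t (excess π v) := by
  rw [sideWeight, sum_add_distrib, sum_const, nsmul_one]

lemma excess_le (π : V → V) (v : V) : excess π v ≤ #{v | π v ≠ v} := by
  refine card_le_card fun w hw => ?_
  rw [mem_filter_univ] at hw ⊢
  exact fun e => hw.2 (by rw [← e, hw.1])

/-- Every member of the family is contained in a model. -/
lemma exists_le_suspModel {n r : ℕ} (hnr : r ≤ n) {G : SimpleGraph V}
    (hG : IsBipartiteSuspension n r G) :
    ∃ (π : V → V) (col : V → Bool), (∀ v, π (π v) = π v) ∧ G ≤ suspModel π col ∧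
      (∀ c, (colorClass π col c).Nonempty) ∧
      #(colorClass π col true) ≤ #(colorClass π col false) ∧ #{v | π v ≠ v} + 2 = r := by
  obtain ⟨hn, B, s, H, ⟨C⟩, hv, hdis, htop, hsum⟩ := hG
  choose f hf using hv
  have hcov : ∀ v, v ∉ B.verts → ∃ i, v ∈ (H i).verts := by
    intro v hvB
    have : v ∈ (B ⊔ ⨆ i, H i).verts := by rw [htop]; trivial
    simpa [hvB] using this
  choose g hg using hcov
  have hfB : ∀ i, f i ∈ B.verts := fun i => by
    have : f i ∈ (H i).verts ∩ B.verts := by rw [hf i]; rfl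
    exact this.2
  -- A vertex outside `B` lies in exactly one suspended graph and goes to the vertex where that
  -- graph meets `B`.
  let π : V → V := fun v => if h : v ∈ B.verts then v else f (g v h)
  have hπB : ∀ v, v ∈ B.verts → π v = v := fun v h => by simp [π, h]
  have hπmem : ∀ v, π v ∈ B.verts := fun v => by
    by_cases h : v ∈ B.verts
    · rw [hπB v h]; exact h
    · simp [π, h, hfB]
  have hcore : ∀ v, π v = v ↔ v ∈ B.verts := fun v =>
    ⟨fun h => h ▸ hπmem v, hπB v⟩
  have huniq : ∀ v, v ∉ B.verts → ∀ i j, v ∈ (H i).verts → v ∈ (H j).verts → i = j := by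
    intro v hvB i j hi hj
    by_contra hij
    exact hvB (hdis i j hij ⟨hi, hj⟩)
  have hπH : ∀ i v, v ∈ (H i).verts → π v = f i := by
    intro i v hi
    by_cases h : v ∈ B.verts
    · have : v ∈ (H i).verts ∩ B.verts := ⟨hi, h⟩
      rw [hf i] at this
      rw [hπB v h, this]
    · have := huniq v h _ _ hi (hg v h)
      simp [π, h, this]
  have hidem : ∀ v, π (π v) = π v := fun v => hπB _ (hπmem v)
  have hadj : ∀ v w, G.Adj v w → B.Adj v w ∨ π v = π w := by
    intro v w hvw
    have : (B ⊔ ⨆ i, H i).Adj v w := by rw [htop]; exact hvw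
    simp only [SimpleGraph.Subgraph.sup_adj, SimpleGraph.Subgraph.iSup_adj] at this
    rcases this with h | ⟨i, h⟩
    · exact Or.inl h
    · exact Or.inr (by rw [hπH i v h.fst_mem, hπH i w h.snd_mem])
  have hcard : #{v | π v ≠ v} + 2 = r := by
    rw [← hsum]
    congr 1
    have : univ.filter (fun v => π v ≠ v) =
        univ.biUnion fun i => ((H i).verts \ B.verts).toFinset := by
      ext v
      simp only [mem_filter_univ, mem_biUnion, mem_univ, true_and, Set.mem_toFinset, Ne, hcore,
        Set.mem_sdiff]
      exact ⟨fun h => ⟨g v h, hg v h, h⟩, fun ⟨i, hi⟩ => hi.2⟩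
    rw [this, card_biUnion]
    · exact sum_congr rfl fun i _ => (Set.ncard_eq_toFinset_card' _).symm
    · intro i _ j _ hij
      rw [Function.onFun, Set.disjoint_toFinset, Set.disjoint_left]
      exact fun v h1 h2 => hij (huniq v h1.2 i j h1.1 h2.1)
  have hle : ∀ col : V → Bool, (∀ v w, B.Adj v w → col v ≠ col w) → G ≤ suspModel π col := by
    intro col hcol v w hvw
    refine ⟨hvw.ne, ?_⟩
    rcases hadj v w hvw with h | h
    · exact Or.inr ⟨hπB v h.fst_mem, hπB w h.snd_mem, hcol v w h⟩
    · exact Or.inl h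
  suffices hmain : ∃ col : V → Bool, G ≤ suspModel π col ∧
      ∀ c, (colorClass π col c).Nonempty by
    obtain ⟨col, h1, h2⟩ := hmain
    rcases le_total (#(colorClass π col true)) (#(colorClass π col false)) with h | h
    · exact ⟨π, col, hidem, h1, h2, h, hcard⟩
    · refine ⟨π, fun v => !col v, hidem, by rwa [suspModel_not], fun c => ?_, ?_, hcard⟩
      · rw [colorClass_not]; exact h2 _
      · rw [colorClass_not, colorClass_not]; exact h
  let col : V → Bool := fun v => if h : v ∈ B.verts then decide (C ⟨v, h⟩ = 0) else false
  have hcol : ∀ v w, B.Adj v w → col v ≠ col w := by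
    intro v w h
    have h1 : C ⟨v, h.fst_mem⟩ ≠ C ⟨w, h.snd_mem⟩ := C.valid h
    simp only [col, h.fst_mem, h.snd_mem, dif_pos]
    rw [Ne, decide_eq_decide]
    omega
  by_cases hne : ∀ c, (colorClass π col c).Nonempty
  · exact ⟨col, hle col hcol, hne⟩
  -- An empty class means that `B` has no edges, so any colouring is proper. As `r ≤ n`, at least
  -- two core vertices exist, and one of them gets its own colour.
  · push Not at hne
    obtain ⟨c, hc⟩ := hne
    have hnoadj : ∀ v w, ¬ B.Adj v w := by
      intro v w h
      have hv' : col v ≠ c := fun e => notMem_empty v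
        (hc ▸ mem_colorClass.2 ⟨hπB v h.fst_mem, e⟩)
      have hw' : col w ≠ c := fun e => notMem_empty w
        (hc ▸ mem_colorClass.2 ⟨hπB w h.snd_mem, e⟩)
      have := hcol v w h
      revert hv' hw' this
      cases col v <;> cases col w <;> cases c <;> simp
    have hcore2 : 1 < #{v | π v = v} := by
      have := card_filter_add_card_filter_not (s := (univ : Finset V)) (fun v => π v = v)
      rw [card_univ, hn] at this
      simp only [Ne] at hcard
      omega
    obtain ⟨x, hx, y, hy, hxy⟩ := one_lt_card.1 hcore2
    rw [mem_filter_univ] at hx hy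
    refine ⟨fun v => decide (v = x), hle _ fun v w h => absurd h (hnoadj v w), fun c => ?_⟩
    cases c
    · exact ⟨y, mem_colorClass.2 ⟨hy, by simpa using Ne.symm hxy⟩⟩
    · exact ⟨x, mem_colorClass.2 ⟨hx, by simp⟩⟩

/-- The extremal property of `turanCircClique`, in terms of the root `t`. -/
lemma specRad_le_and_nonempty_iso {n m p : ℕ} {t : ℝ} (hm : 2 ≤ m) (hn : m + p = n) (hp : 1 ≤ p)
    (hpm : 2 * p + 1 ≤ m / 2) (htm : ((m / 2 : ℕ) : ℝ) ≤ t)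
    (h : t ^ 2 = ((m / 2 : ℕ) : ℝ) * ((m + 1) / 2 : ℕ) + ((m + 1) / 2 : ℕ) * gain t p)
    {G : SimpleGraph V} (hG : IsBipartiteSuspension n (p + 2) G) :
    specRad G ≤ ENNReal.ofReal t ∧ (specRad G = ENNReal.ofReal t →
      Nonempty (G ≃g turanCircClique m (p + 1) hm (by omega))) := by
  obtain ⟨π, col, hπ, hGle, hne, hab, hcard⟩ := exists_le_suspModel (by omega) hG
  have hcard' : #{v | π v ≠ v} = p := by omega
  have hVn := hG.1
  have hsum := card_colorClass_add π col
  have hex := sum_excess (col := col) hπ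
  rw [hcard', hVn] at hsum
  rw [hcard'] at hex
  have hpt : 2 * (p : ℝ) + 1 ≤ t := le_trans (by exact_mod_cast hpm) htm
  have hp0 : (1 : ℝ) ≤ p := by exact_mod_cast hp
  have ht : 0 < t := by linarith
  have hx : ∀ v, (excess π v : ℝ) < t := fun v => by
    have h1 := excess_le π v
    rw [hcard'] at h1
    have : (excess π v : ℝ) ≤ p := by exact_mod_cast h1
    linarith
  have hexR : ∑ v ∈ colorClass π col true, (excess π v : ℝ) +
      ∑ v ∈ colorClass π col false, (excess π v : ℝ) = p := by exact_mod_cast hex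
  have hS : ∀ c, 0 ≤ ∑ v ∈ colorClass π col c, (excess π v : ℝ) := fun c =>
    sum_nonneg fun v _ => Nat.cast_nonneg _
  have hF : ∀ c, 0 ≤ ∑ v ∈ colorClass π col c, gain t (excess π v) := fun c =>
    sum_nonneg fun v _ => gain_nonneg (Nat.cast_nonneg _) (hx v)
  have hFle : ∀ c, ∑ v ∈ colorClass π col c, gain t (excess π v) ≤
      gain t (∑ v ∈ colorClass π col c, (excess π v : ℝ)) := fun c =>
    sum_gain_le _ _ (fun v _ => Nat.cast_nonneg _) rfl
      (by cases c <;> linarith [hS true, hS false])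
  have hgain := gain_add_le (hS true) (hS false) (by linarith : _ < t)
  rw [hexR] at hgain
  have hf : ∑ v ∈ colorClass π col true, gain t (excess π v) +
      ∑ v ∈ colorClass π col false, gain t (excess π v) +
      (∑ v ∈ colorClass π col true, gain t (excess π v)) *
      ∑ v ∈ colorClass π col false, gain t (excess π v) ≤ gain t p := by
    -- Merge the cliques within each class, then the two resulting cliques across the classes.
    refine le_trans ?_ hgain
    exact add_le_add (add_le_add (hFle true) (hFle false))
      (mul_le_mul (hFle true) (hFle false) (hF false) ((hF true).trans (hFle true)))
  have hf1 : gain t p < 1 := gain_lt_one (by linarith) (by linarith)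
  have hprod := prod_le_of_le hab (by omega : _ = m) (by omega) (hF true) (hF false) hf hf1
  rw [← sideWeight_eq, ← sideWeight_eq, ← h] at hprod
  refine ⟨specRad_le_of_le_suspModel hπ ht hx hne hprod hGle, fun hs => ?_⟩
  obtain ⟨hGeq, hpeq⟩ := eq_suspModel_of_specRad_eq hπ ht hx hne hprod hGle hs
  rw [h, sideWeight_eq, sideWeight_eq] at hpeq
  obtain ⟨ha, hb, hcase⟩ := eq_of_prod_eq hab (by omega) (by omega) (hF true) (hF false) hf hf1 hpeq
  have hconc : ∀ c, ∑ v ∈ colorClass π col c, gain t (excess π v) = gain t p →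
      ∃ u ∈ colorClass π col c, ∀ v, π v ≠ v → π v = u := by
    intro c hc
    obtain ⟨u, hu, hup⟩ := exists_eq_of_sum_gain_eq _ _ (fun v _ => Nat.cast_nonneg _)
      (by cases c <;> linarith [hS true, hS false]) (by linarith) (by linarith) hc
    refine ⟨u, hu, apply_eq_of_excess_eq ?_⟩
    rw [hcard']
    exact_mod_cast hup
  have hq : 1 ≤ p + 1 := by omega
  obtain ⟨hT1, hT2⟩ := card_colorClass_turan hm hq
  have hTu : (.inl ⟨1, hm⟩ : Fin m ⊕ {w : Fin (p + 1) // w ≠ ⟨0, hq⟩}) ∈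
      colorClass (turanRetract hm hq) (turanColor m hq) true :=
    mem_colorClass.2 ⟨by rfl, by rfl⟩
  have hTπ : ∀ v, turanRetract hm hq v ≠ v → turanRetract hm hq v = .inl ⟨1, hm⟩ := by
    rintro (x | w) hv
    · exact absurd rfl hv
    · rfl
  have hVT : Fintype.card V = Fintype.card (Fin m ⊕ {w : Fin (p + 1) // w ≠ ⟨0, hq⟩}) := by
    rw [Fintype.card_sum, Fintype.card_fin, card_ne_zero_fin hq, hVn]; omega
  rw [turanCircClique_eq, hGeq]
  rcases hcase with ⟨h1, -⟩ | ⟨hab', -, h2⟩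
  · obtain ⟨u, hu, hπu⟩ := hconc true h1
    exact nonempty_iso_of_concentrated hu hTu hπu hTπ (by rw [ha, hT1]) (by rw [hb, hT2]) hVT
  -- The clique sits in the other class of a balanced core with `a = b`; exchanging the colours
  -- reduces to the previous case.
  · obtain ⟨u, hu, hπu⟩ := hconc false h2
    rw [← suspModel_not]
    refine nonempty_iso_of_concentrated (u := u) (by rw [colorClass_not]; exact hu) hTu hπu hTπ
      ?_ ?_ hVT
    · rw [colorClass_not, hT1, ← ha, hab', Bool.not_true]
    · rw [colorClass_not, hT2, ← hb, ← hab', Bool.not_false]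

end Extremal

end SpectralSuspension

open SpectralSuspension in
theorem mainTheorem6 (n k r : ℕ) (hn : 100 * k ≤ n) (hr : 3 ≤ r) (hrk : r ≤ 10 * k) :
    IsBipartiteSuspension n r
      (turanCircClique (n - r + 2) (r - 1) (by omega) (by omega)) ∧
    (∀ (V : Type*) [Fintype V] (G : SimpleGraph V), IsBipartiteSuspension n r G →
      specRad G ≤ specRad (turanCircClique (n - r + 2) (r - 1) (by omega) (by omega)) ∧
      (specRad G = specRad (turanCircClique (n - r + 2) (r - 1) (by omega) (by omega)) ↔
        Nonempty (G ≃g turanCircClique (n - r + 2) (r - 1) (by omega) (by omega)))) ∧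
    (∀ s : ℕ, ∀ hrs : r < s, s ≤ 10 * k →
      specRad (turanCircClique (n - s + 2) (s - 1) (by omega) (by omega)) <
        specRad (turanCircClique (n - r + 2) (r - 1) (by omega) (by omega))) := by
  obtain ⟨p, rfl⟩ : ∃ p, r = p + 2 := ⟨r - 2, by omega⟩
  obtain ⟨t, htm, ht⟩ := exists_extremal_root (m := n - (p + 2) + 2) (p := p) (by omega)
  have hpm : 2 * p + 1 ≤ (n - (p + 2) + 2) / 2 := by omega
  have hpm' : 2 * (p : ℝ) + 1 ≤ ((n - (p + 2) + 2) / 2 : ℕ) := by exact_mod_cast hpm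
  have hpt : ((p + 2 - 1 - 1 : ℕ) : ℝ) < t := by
    rw [show p + 2 - 1 - 1 = p by omega]
    have : (0 : ℝ) ≤ p := Nat.cast_nonneg p
    linarith
  have hT : specRad (turanCircClique (n - (p + 2) + 2) (p + 2 - 1) (by omega) (by omega)) =
      ENNReal.ofReal t := specRad_turanCircClique _ _ hpt ht
  refine ⟨?_, fun V _ G hG => ?_, fun s hrs hs => ?_⟩
  · have := turanCircClique_isBipartiteSuspension (m := n - (p + 2) + 2) (q := p + 2 - 1)
      (by omega) (by omega)
    rwa [show n - (p + 2) + 2 + (p + 2 - 1) - 1 = n by omega,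
      show p + 2 - 1 + 1 = p + 2 by omega] at this
  · obtain ⟨h1, h2⟩ := specRad_le_and_nonempty_iso (m := n - (p + 2) + 2) (by omega) (by omega)
      (by omega) hpm htm ht hG
    exact ⟨h1.trans hT.ge, fun h => h2 (h.trans hT), fun ⟨e⟩ => specRad_congr e⟩
  · rw [hT]
    obtain ⟨d, rfl⟩ : ∃ d, s = d + 2 := ⟨s - 2, by omega⟩
    have hdm : 2 * (d : ℝ) + 1 ≤ ((n - (p + 2) + 2) / 2 : ℕ) := by
      exact_mod_cast (by omega : 2 * d + 1 ≤ (n - (p + 2) + 2) / 2)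
    have hd0 : (0 : ℝ) ≤ d := Nat.cast_nonneg d
    have hp0 : (0 : ℝ) ≤ p := Nat.cast_nonneg p
    -- From `t ≥ 2 * d + 1` the denominator is at least `2 * (d + 1) ^ 2`.
    have hg1 : gain t d < 1 / 2 := by
      unfold gain
      rw [div_lt_iff₀ (mul_pos (by linarith) (by linarith))]
      nlinarith
    have hg2 : 0 ≤ gain t p := gain_nonneg hp0 (by linarith)
    refine specRad_turanCircClique_lt _ _ ?_ ?_
    · rw [show d + 2 - 1 - 1 = d by omega]
      linarith
    · rw [show d + 2 - 1 - 1 = d by omega, ht]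
      clear hT
      generalize hM : n - (p + 2) + 2 = M at *
      generalize hN : n - (d + 2) + 2 = N at *
      -- Since `N < M`, the larger core gains at least `N / 2` in the product. This beats half of
      -- `(N + 1) / 2`, which bounds the contribution of the clique.
      have hMN : N / 2 * ((N + 1) / 2) + N / 2 ≤ M / 2 * ((M + 1) / 2) :=
        calc N / 2 * ((N + 1) / 2) + N / 2 ≤ (N + 1) / 2 * ((N + 1 + 1) / 2) := by
              rcases Nat.even_or_odd' N with ⟨c, rfl | rfl⟩
              · rw [show 2 * c / 2 = c by omega, show (2 * c + 1) / 2 = c by omega,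
                  show (2 * c + 1 + 1) / 2 = c + 1 by omega]
                nlinarith
              · rw [show (2 * c + 1) / 2 = c by omega, show (2 * c + 1 + 1) / 2 = c + 1 by omega,
                  show (2 * c + 1 + 1 + 1) / 2 = c + 1 by omega]
                nlinarith
          _ ≤ M / 2 * ((M + 1) / 2) := Nat.mul_le_mul (by omega) (by omega)
      have hMN' : ((N / 2 : ℕ) : ℝ) * ((N + 1) / 2 : ℕ) + (N / 2 : ℕ) ≤
          ((M / 2 : ℕ) : ℝ) * ((M + 1) / 2 : ℕ) := by exact_mod_cast hMN
      have hN2 : (((N + 1) / 2 : ℕ) : ℝ) ≤ (N / 2 : ℕ) + 1 := by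
        exact_mod_cast (by omega : (N + 1) / 2 ≤ N / 2 + 1)
      have hN1 : (1 : ℝ) ≤ (N / 2 : ℕ) := by exact_mod_cast (by omega : 1 ≤ N / 2)
      have hN0 : (0 : ℝ) < ((N + 1) / 2 : ℕ) := by exact_mod_cast (by omega : 0 < (N + 1) / 2)
      have hM0 : (0 : ℝ) ≤ ((M + 1) / 2 : ℕ) := Nat.cast_nonneg _
      have := mul_lt_mul_of_pos_left hg1 hN0
      have := mul_nonneg hM0 hg2
      linarith
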